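/- A congestion game $\Gamma$ consists of a finite set $N$ of players, a finite set $E$ of resources, for each player $i$ a nonempty family $S_i\subseteq 2^E$ of strategies, and for each resource $e$ a cost function $c_e:\mathbb N\to[0,\infty)$. In the deterministic game the cost of player $i$ under the profile $s=(s_i)_{i\in N}$ is $C_i(s)=\sum_{e\in s_i}c_e(|\{j\in N: e\in s_j\}|)$. In the Bernoulli game $\Gamma^p$ each player is active independently with probability $p$, and with $A$ the random set of active players the cost of player $i$ is $C_i(s)=\mathbb E\big[\mathbf 1_{\{i\in A\}}\sum_{e\in s_i}c_e(|\{j\in A: e\in s_j\}|)\big]$. In either case the social cost is $C(s)=\sum_{i\in N}C_i(s)$, a profile is an equilibrium if no player can lower her cost by a unilateral change of strategy, and the price of stability is $$\mathrm{PoS}=\min_{s\text{ equilibrium}}\frac{C(s)}{\min_{s'}C(s')}$$ (with the conventions $0/0=0$ and $a/0=\infty$ for $a>0$). **Theorem.** Let $0<p\le 1$, and let $\mathrm{PoS}(p)$ be the supremum of $\mathrm{PoS}(\Gamma^p)$ over all congestion games $\Gamma$ with costs of the form $c_e(x)=a_ex+b_e$, $a_e,b_e\ge 0$. Then $$\mathrm{PoS}(p)=\begin{cases}4/3&\text{if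 }0<p\le 1/4,\\[2pt] 1+\sqrt{p/(2+p)}&\text{if }1/4\le p\le 1.\end{cases}$$ The same formula holds for the supremum of $\mathrm{PoS}(\Gamma)$ over all deterministic congestion games $\Gamma$ each of whose costs has, for $x\ge1$, the form $c^p(x)=p\,\mathbb E[c(1+X)]$, where $X\sim\mathrm{Binomial}(x-1,p)$ and $c(x)=ax+b$ with $a,b\ge0$. -/

import Mathlib

open scoped ENNReal

/-- An atomic congestion game: finitely many players, finitely many resources, for each player a
nonempty family of feasible sets of resources, and for each resource a nonnegative cost depending
on its load. -/
structure CongestionGame where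
  Player : Type
  Resource : Type
  [playerFintype : Fintype Player]
  [playerDecEq : DecidableEq Player]
  [resourceFintype : Fintype Resource]
  [resourceDecEq : DecidableEq Resource]
  strategies : Player → Finset (Finset Resource)
  strategies_nonempty : ∀ i, (strategies i).Nonempty
  cost : Resource → ℕ → ℝ
  cost_nonneg : ∀ e k, 0 ≤ cost e k

namespace CongestionGame

attribute [instance] playerFintype playerDecEq resourceFintype resourceDecEq

variable (Γ : CongestionGame)

/-- Strategy profiles: every player chooses one of her feasible strategies. -/
abbrev Profile : Type := ∀ i : Γ.Player, {t : Finset Γ.Resource // t ∈ Γ.strategies i}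

/-- The number of players of the set `I` whose strategy uses the resource `e`. -/
def loadOf (I : Finset Γ.Player) (s : Γ.Profile) (e : Γ.Resource) : ℕ :=
  (I.filter fun j => e ∈ (s j).1).card

/-- The cost of player `i` in the deterministic game. -/
def playerCost (s : Γ.Profile) (i : Γ.Player) : ℝ :=
  ∑ e ∈ (s i).1, Γ.cost e (Γ.loadOf Finset.univ s e)

/-- The probability that `I` is exactly the set of active players, when the players are active
independently of each other and player `j` is active with probability `q j`. -/
noncomputable def activeProb (q : Γ.Player → ℝ) (I : Finset Γ.Player) : ℝ :=
  (∏ j ∈ I, q j) * ∏ j ∈ Finset.univ \ I, (1 - q j)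

/-- The expected cost of player `i` in the Bernoulli game with participation probabilities `q`:
only active players load the resources, and an inactive player has cost zero. -/
noncomputable def bernoulliCost (q : Γ.Player → ℝ) (s : Γ.Profile) (i : Γ.Player) : ℝ :=
  ∑ I : Finset Γ.Player,
    Γ.activeProb q I * (if i ∈ I then ∑ e ∈ (s i).1, Γ.cost e (Γ.loadOf I s e) else 0)

variable {Γ}

/-- `s` is a pure equilibrium for the individual costs `C`: no player gains by a unilateral
deviation. -/
def IsEquilibrium (C : Γ.Profile → Γ.Player → ℝ) (s : Γ.Profile) : Prop :=
  ∀ (i : Γ.Player) (t : {t : Finset Γ.Resource // t ∈ Γ.strategies i}),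
    C s i ≤ C (Function.update s i t) i

/-- The social cost: the sum of the individual costs. -/
def socialCost (C : Γ.Profile → Γ.Player → ℝ) (s : Γ.Profile) : ℝ := ∑ i, C s i

/-- The optimal social cost, the minimum over the finitely many profiles. -/
noncomputable def optimalCost (C : Γ.Profile → Γ.Player → ℝ) : ℝ≥0∞ :=
  ⨅ s : Γ.Profile, ENNReal.ofReal (socialCost C s)

/-- The price of stability: the minimum of the ratio of social cost and optimal cost over all
equilibria. In `ℝ≥0∞` the degenerate ratio `0 / 0` is `0` and `a / 0 = ∞` for `a > 0`. -/
noncomputable def priceOfStability (C : Γ.Profile → Γ.Player → ℝ) : ℝ≥0∞ :=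
  ⨅ s ∈ {s : Γ.Profile | IsEquilibrium C s}, ENNReal.ofReal (socialCost C s) / optimalCost C

end CongestionGame

/-- The nondecreasing and nonnegative affine costs `x ↦ a x + b`. -/
def affineCosts : Set (ℕ → ℝ) :=
  {c | ∃ a b : ℝ, 0 ≤ a ∧ 0 ≤ b ∧ ∀ x : ℕ, c x = a * x + b}

/-- The expected cost `p * 𝔼[c (1 + X)]` with `X` binomial of parameters `x - 1` and `p`, for a
resource chosen by `x ≥ 1` players. The value at `x = 0` plays no role. -/
noncomputable def expectedCost (p : ℝ) (c : ℕ → ℝ) (x : ℕ) : ℝ :=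
  p * ∑ k ∈ Finset.range (x - 1 + 1),
    ((x - 1).choose k : ℝ) * p ^ k * (1 - p) ^ (x - 1 - k) * c (1 + k)

/-- The congestion games all of whose costs belong to the class `K`. -/
def gamesWithCosts (K : Set (ℕ → ℝ)) : Set CongestionGame :=
  {Γ | ∀ e, Γ.cost e ∈ K}

/-- The supremum of the price of stability over all Bernoulli congestion games with affine costs in
which every player is active with probability `p`. -/
noncomputable def bernoulliWorstPoS (p : ℝ) : ℝ≥0∞ :=
  ⨆ Γ ∈ gamesWithCosts affineCosts,
    CongestionGame.priceOfStability (CongestionGame.bernoulliCost Γ fun _ => p)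

/-- The supremum of the price of stability over all deterministic congestion games whose costs are
the expected costs `expectedCost p c` of affine costs `c`. -/
noncomputable def expectedWorstPoS (p : ℝ) : ℝ≥0∞ :=
  ⨆ Γ ∈ gamesWithCosts (expectedCost p '' affineCosts),
    CongestionGame.priceOfStability (CongestionGame.playerCost Γ)

/-!
For affine costs `c x = a * x + b`, a user of a resource with load `x` pays, in expectation, `p`
times `a * (1 + p * (x - 1)) + b`, both in the Bernoulli game and in the deterministic game with
costs `expectedCost p c` (`hasExpectedAffineCosts_bernoulliCost`,
`hasExpectedAffineCosts_playerCost`). Both suprema therefore concern the same class of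
deterministic games, abstracted in `HasExpectedAffineCosts`. Write the claimed value as `1 + t`, so
that `t = 1 / 3` if `p ≤ 1 / 4`, and `t ^ 2 * (2 + p) = p` otherwise.

*Upper bound.* Let `s` minimize Rosenthal's potential `Φ`; it is an equilibrium. For every profile
`o`, with weights `ν` and `1 + t - ν`, add up the two inequalities
`C(s) ≤ ∑ e, y * f (x + 1)` (no player gains by deviating to `o`; here `x` and `y` are the loads of
`e` under `s` and `o`) and `Φ(s) ≤ Φ(o)`. The resulting bound `C(s) ≤ (1 + t) * C(o)` holds resource
by resource (`resource_inequality`). For resources of cost `1 + p * (x - 1)` it amounts to an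
inequality between a perfect square and linear terms which is true for natural numbers
(`sq_add_nonneg_of_nat`), provided that `2 * t * ν = 1 - t ^ 2` and `p * ν ≤ t`. The weights are
nonnegative for `ν = t / p` when `1 / 4 ≤ p`, and for `ν = 1 + t = 4 / 3` when `p ≤ 1 / 4`.

*Lower bound.* The cases of equality above dictate the game `gadget`: there is a resource common to
all players, whose loads in the equilibrium and in a cheaper profile are asymptotically in the ratio
`1 + t : 1 - t`; an outside option of constant cost; and links that are used by exactly one player
in either profile, but (off the diagonal) by a different one. With slope `β ≤ 1 / 2` on the links
and a suitable constant for the outside option, the strategy containing the common resource is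
strictly dominant (`eq_true_of_isEquilibrium_gadgetProfile`), so that there is only one equilibrium.
As the number of players grows, the ratio of the social costs tends to `1 + t`
(`ofReal_le_of_gadget`), with `β = 1 / 2` if `1 / 4 ≤ p` and `β = 0` if `p ≤ 1 / 4`.
-/

namespace CongestionGame

variable {Γ : CongestionGame}

/-! ### Loads and resource-wise sums -/

theorem sum_sum_strategy_eq (s : Γ.Profile) (F : Γ.Resource → ℝ) :
    ∑ i, ∑ e ∈ (s i).1, F e = ∑ e, (Γ.loadOf Finset.univ s e : ℝ) * F e := by
  have h : ∀ i, ∑ e ∈ (s i).1, F e = ∑ e, if e ∈ (s i).1 then F e else 0 := fun i => by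
    rw [Finset.sum_ite_mem, Finset.univ_inter]
  simp_rw [h]
  rw [Finset.sum_comm]
  refine Finset.sum_congr rfl fun e _ => ?_
  rw [← Finset.sum_filter, Finset.sum_const, nsmul_eq_mul, loadOf]

theorem loadOf_univ_eq_erase_add (s : Γ.Profile) (i : Γ.Player) (e : Γ.Resource) :
    Γ.loadOf Finset.univ s e =
      Γ.loadOf (Finset.univ.erase i) s e + if e ∈ (s i).1 then 1 else 0 := by
  unfold loadOf
  conv_lhs => rw [← Finset.insert_erase (Finset.mem_univ i), Finset.filter_insert]
  split_ifs with h
  · rw [Finset.card_insert_of_notMem (by simp)]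
  · rfl

theorem loadOf_erase_update (s : Γ.Profile) (i : Γ.Player)
    (t : {t : Finset Γ.Resource // t ∈ Γ.strategies i}) (e : Γ.Resource) :
    Γ.loadOf (Finset.univ.erase i) (Function.update s i t) e =
      Γ.loadOf (Finset.univ.erase i) s e := by
  unfold loadOf
  congr 1
  refine Finset.filter_congr fun j hj => ?_
  rw [Function.update_of_ne (Finset.ne_of_mem_erase hj)]

instance : Nonempty Γ.Profile :=
  ⟨fun i => ⟨(Γ.strategies_nonempty i).choose, (Γ.strategies_nonempty i).choose_spec⟩⟩

/-! ### Expected affine costs -/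

/-- The individual costs `C` are those of a deterministic game in which a resource `e` with load
`x` costs each of its users `a e * (1 + p * (x - 1)) + b e`. Up to the factor `p`, this is the cost
a user expects, conditionally on being active, when the other `x - 1` users are active with
probability `p`. -/
def HasExpectedAffineCosts (p : ℝ) (a b : Γ.Resource → ℝ) (C : Γ.Profile → Γ.Player → ℝ) : Prop :=
  ∀ s i, C s i = ∑ e ∈ (s i).1, (a e * (1 + p * ((Γ.loadOf Finset.univ s e : ℝ) - 1)) + b e)

/-- The probability that all players of `J` are active is the product of their probabilities. -/
theorem sum_activeProb_subset (q : Γ.Player → ℝ) (J : Finset Γ.Player) :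
    ∑ I : Finset Γ.Player, Γ.activeProb q I * (if J ⊆ I then 1 else 0) = ∏ j ∈ J, q j := by
  -- Expand `∏ j, (q j + g j)`, where `g` is `1 - q` off `J` and kills every `I` not containing `J`.
  have h := Finset.prod_add q (fun j => if j ∈ J then 0 else 1 - q j) Finset.univ
  have h1 : ∏ j, (q j + if j ∈ J then 0 else 1 - q j) = ∏ j ∈ J, q j := by
    rw [← Finset.prod_subset (Finset.subset_univ J)]
    · exact Finset.prod_congr rfl fun j hj => by simp [hj]
    · intro j _ hj
      simp [hj]
  rw [← h1, h, Finset.powerset_univ]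
  refine Finset.sum_congr rfl fun I _ => ?_
  unfold activeProb
  split_ifs with hJ
  · rw [mul_one]
    congr 1
    refine Finset.prod_congr rfl fun j hj => ?_
    rw [if_neg fun hjJ => (Finset.mem_sdiff.1 hj).2 (hJ hjJ)]
  · obtain ⟨j, hj, hjI⟩ := Finset.not_subset.1 hJ
    have h0 : (∏ k ∈ Finset.univ \ I, if k ∈ J then 0 else 1 - q k) = 0 :=
      Finset.prod_eq_zero (i := j) (by simp [hjI]) (by simp [hj])
    rw [h0, mul_zero, mul_zero]

theorem hasExpectedAffineCosts_bernoulliCost (p : ℝ) (a b : Γ.Resource → ℝ)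
    (hc : ∀ e x, Γ.cost e x = a e * x + b e) :
    HasExpectedAffineCosts p (fun e => p * a e) (fun e => p * b e)
      (Γ.bernoulliCost fun _ => p) := by
  intro s i
  unfold bernoulliCost
  have hexp : ∀ I : Finset Γ.Player,
      Γ.activeProb (fun _ => p) I *
        (if i ∈ I then ∑ e ∈ (s i).1, Γ.cost e (Γ.loadOf I s e) else 0) =
      ∑ e ∈ (s i).1, (a e * (∑ j with e ∈ (s j).1,
          Γ.activeProb (fun _ => p) I * (if {i, j} ⊆ I then 1 else 0)) +
        b e * (Γ.activeProb (fun _ => p) I * (if {i} ⊆ I then 1 else 0))) := by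
    intro I
    by_cases hi : i ∈ I
    · simp only [hi, if_true, Finset.mul_sum, Finset.singleton_subset_iff, Finset.insert_subset_iff,
        true_and]
      refine Finset.sum_congr rfl fun e _ => ?_
      rw [hc, ← Finset.mul_sum, ← Finset.mul_sum]
      have : (Γ.loadOf I s e : ℝ) = ∑ j with e ∈ (s j).1, if j ∈ I then (1 : ℝ) else 0 := by
        rw [Finset.sum_boole, loadOf, Finset.filter_filter]
        congr 2
        ext j
        simp [and_comm]
      rw [this]
      ring
    · simp [hi, Finset.insert_subset_iff]
  simp_rw [hexp]
  rw [Finset.sum_comm]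
  refine Finset.sum_congr rfl fun e he => ?_
  rw [Finset.sum_add_distrib, ← Finset.mul_sum, ← Finset.mul_sum, Finset.sum_comm,
    sum_activeProb_subset]
  simp_rw [sum_activeProb_subset]
  have hi : i ∈ Finset.univ.filter (fun j => e ∈ (s j).1) := by simp [he]
  rw [← Finset.add_sum_erase _ _ hi]
  have h2 : ∀ j ∈ (Finset.univ.filter (fun j => e ∈ (s j).1)).erase i,
      ∏ _k ∈ ({i, j} : Finset Γ.Player), p = p ^ 2 := fun j hj => by
    rw [Finset.prod_const, Finset.card_pair (Finset.ne_of_mem_erase hj).symm]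
  rw [Finset.sum_congr rfl h2, Finset.sum_const, nsmul_eq_mul, Finset.card_erase_of_mem hi,
    Nat.cast_sub (Finset.card_pos.2 ⟨i, hi⟩)]
  simp only [Finset.pair_eq_singleton, Finset.prod_singleton, loadOf, Nat.cast_one]
  ring

end CongestionGame

/-- The first two moments of the binomial distribution, taken from the Bernstein polynomials. -/
theorem expectedCost_affine (p a b : ℝ) (c : ℕ → ℝ) (hc : ∀ x : ℕ, c x = a * x + b) (x : ℕ) :
    expectedCost p c x = p * (a * (1 + p * ((x - 1 : ℕ) : ℝ)) + b) := by
  unfold expectedCost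
  generalize x - 1 = n
  have h0 := congrArg (Polynomial.eval p) (bernsteinPolynomial.sum ℝ n)
  have h1 := congrArg (Polynomial.eval p) (bernsteinPolynomial.sum_smul ℝ n)
  simp only [bernsteinPolynomial, Polynomial.eval_finsetSum, Polynomial.eval_mul,
    Polynomial.eval_pow, Polynomial.eval_sub, Polynomial.eval_one, Polynomial.eval_X,
    Polynomial.eval_natCast, nsmul_eq_mul] at h0 h1
  have : ∀ k : ℕ, (n.choose k : ℝ) * p ^ k * (1 - p) ^ (n - k) * c (1 + k) =
      (a + b) * ((n.choose k : ℝ) * p ^ k * (1 - p) ^ (n - k)) +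
        a * ((k : ℝ) * ((n.choose k : ℝ) * p ^ k * (1 - p) ^ (n - k))) := fun k => by
    rw [hc]; push_cast; ring
  simp_rw [this]
  rw [Finset.sum_add_distrib, ← Finset.mul_sum, ← Finset.mul_sum, h0, h1]
  ring

namespace CongestionGame

variable {Γ : CongestionGame}

theorem hasExpectedAffineCosts_playerCost (p : ℝ) (a b : Γ.Resource → ℝ)
    (hc : ∀ e, ∃ c : ℕ → ℝ, (∀ x : ℕ, c x = a e * x + b e) ∧ Γ.cost e = expectedCost p c) :
    HasExpectedAffineCosts p (fun e => p * a e) (fun e => p * b e) Γ.playerCost := by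
  intro s i
  refine Finset.sum_congr rfl fun e he => ?_
  obtain ⟨c, hc, hce⟩ := hc e
  have hpos : 1 ≤ Γ.loadOf Finset.univ s e := Finset.card_pos.2 ⟨i, by simp [he]⟩
  rw [hce, expectedCost_affine p _ _ c hc, Nat.cast_sub hpos]
  push_cast
  ring

/-! ### The upper bound -/

theorem HasExpectedAffineCosts.socialCost_eq {p : ℝ} {a b : Γ.Resource → ℝ}
    {C : Γ.Profile → Γ.Player → ℝ} (hC : HasExpectedAffineCosts p a b C) (s : Γ.Profile) :
    socialCost C s = ∑ e, (Γ.loadOf Finset.univ s e : ℝ) *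
      (a e * (1 + p * ((Γ.loadOf Finset.univ s e : ℝ) - 1)) + b e) := by
  unfold socialCost
  simp_rw [hC s]
  exact sum_sum_strategy_eq s _

/-- Rosenthal's potential, which adds `a e * (1 + p * (k - 1)) + b e` over `1 ≤ k ≤ x` for each
resource `e` of load `x`. -/
noncomputable def potential (p : ℝ) (a b : Γ.Resource → ℝ) (s : Γ.Profile) : ℝ :=
  ∑ e, (a e * (Γ.loadOf Finset.univ s e + p * (Γ.loadOf Finset.univ s e *
    ((Γ.loadOf Finset.univ s e : ℝ) - 1) / 2)) + b e * Γ.loadOf Finset.univ s e)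

theorem HasExpectedAffineCosts.eq_sum_erase {p : ℝ} {a b : Γ.Resource → ℝ}
    {C : Γ.Profile → Γ.Player → ℝ} (hC : HasExpectedAffineCosts p a b C) (s : Γ.Profile)
    (i : Γ.Player) :
    C s i = ∑ e ∈ (s i).1, (a e * (1 + p * Γ.loadOf (Finset.univ.erase i) s e) + b e) := by
  rw [hC s i]
  refine Finset.sum_congr rfl fun e he => ?_
  rw [loadOf_univ_eq_erase_add s i e, if_pos he]
  push_cast
  ring

/-- The difference of the potential and the cost of player `i` depends only on the strategies of
the other players. -/
theorem HasExpectedAffineCosts.potential_eq {p : ℝ} {a b : Γ.Resource → ℝ}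
    {C : Γ.Profile → Γ.Player → ℝ} (hC : HasExpectedAffineCosts p a b C) (s : Γ.Profile)
    (i : Γ.Player) :
    potential p a b s = C s i + ∑ e, (a e * (Γ.loadOf (Finset.univ.erase i) s e +
      p * (Γ.loadOf (Finset.univ.erase i) s e *
        ((Γ.loadOf (Finset.univ.erase i) s e : ℝ) - 1) / 2)) +
      b e * Γ.loadOf (Finset.univ.erase i) s e) := by
  rw [hC.eq_sum_erase, ← Finset.univ_inter (s i).1, ← Finset.sum_ite_mem,
    ← Finset.sum_add_distrib]
  refine Finset.sum_congr rfl fun e _ => ?_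
  rw [loadOf_univ_eq_erase_add s i e]
  split_ifs
  · push_cast; ring
  · push_cast; ring

theorem HasExpectedAffineCosts.isEquilibrium_of_potential_le {p : ℝ} {a b : Γ.Resource → ℝ}
    {C : Γ.Profile → Γ.Player → ℝ} (hC : HasExpectedAffineCosts p a b C) {s : Γ.Profile}
    (hs : ∀ s', potential p a b s ≤ potential p a b s') : IsEquilibrium C s := by
  intro i t
  have h := hs (Function.update s i t)
  rw [hC.potential_eq s i, hC.potential_eq _ i] at h
  simp_rw [loadOf_erase_update] at h
  linarith

/-- In an equilibrium `s`, comparing with the deviation of every player to her strategy in `o`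
gives `C(s) ≤ ∑ e, y * f (x + 1)`, where `x` and `y` are the loads of `e` under `s` and `o`. -/
theorem HasExpectedAffineCosts.socialCost_le_of_isEquilibrium {p : ℝ} (hp : 0 ≤ p)
    {a b : Γ.Resource → ℝ} (ha : ∀ e, 0 ≤ a e)
    {C : Γ.Profile → Γ.Player → ℝ} (hC : HasExpectedAffineCosts p a b C) {s : Γ.Profile}
    (hs : IsEquilibrium C s) (o : Γ.Profile) :
    socialCost C s ≤ ∑ e, (Γ.loadOf Finset.univ o e : ℝ) *
      (a e * (1 + p * Γ.loadOf Finset.univ s e) + b e) := by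
  rw [← sum_sum_strategy_eq]
  refine Finset.sum_le_sum fun i _ => (hs i (o i)).trans ?_
  rw [hC.eq_sum_erase, Function.update_self]
  refine Finset.sum_le_sum fun e _ => ?_
  rw [loadOf_erase_update]
  have hle : Γ.loadOf (Finset.univ.erase i) s e ≤ Γ.loadOf Finset.univ s e := by
    rw [loadOf_univ_eq_erase_add s i e]; exact Nat.le_add_right _ _
  have := ha e
  gcongr

/-- The quadratic inequality behind the upper bound. Equality holds at `(0, 1)` and `(1, 1)`, and
asymptotically along the ray `(1 - t) * x = (1 + t) * y`; for real `x` and `y` the inequality is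
false. -/
theorem sq_add_nonneg_of_nat {t : ℝ} (ht : 1 / 3 ≤ t) (ht1 : t < 1) (x y : ℕ) :
    (1 + t) ^ 2 * y ≤ ((1 - t) * x - (1 + t) * y) ^ 2 + (1 - t) * (1 + 3 * t) * x := by
  have hx : (0 : ℝ) ≤ x := x.cast_nonneg
  have h1 : 0 < 1 - t := by linarith
  rcases y with _ | _ | y
  · simp only [Nat.cast_zero, mul_zero]
    positivity
  · have hxx : (0 : ℝ) ≤ (x : ℝ) * (x - 1) := by
      rcases x with _ | x
      · simp
      · rw [Nat.cast_succ, add_sub_cancel_right]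
        positivity
    have : 0 ≤ (1 - t) ^ 2 * ((x : ℝ) * (x - 1)) := by positivity
    push_cast
    nlinarith
  · push_cast
    have hy : (0 : ℝ) ≤ y := y.cast_nonneg
    -- In `u = (1 - t) * x - (1 + t) * y` the claim is `0 ≤ u ^ 2 + (1 + 3t) u + 2t (1 + t) y`.
    have hsq := sq_nonneg ((1 - t) * (x : ℝ) - (1 + t) * (y + 2) + (1 + 3 * t) / 2)
    have hty : 0 ≤ t * (1 + t) * (y : ℝ) := by positivity
    nlinarith

/-- The inequality for a single resource with loads `x` in equilibrium and `y` in the optimum. The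
weights `ν` and `1 + t - ν` belong to the equilibrium condition and to the comparison of the
potentials. -/
theorem resource_inequality {p t ν : ℝ} (hp : 0 < p) (ht : 1 / 3 ≤ t) (ht1 : t < 1)
    (hν : 2 * t * ν = 1 - t ^ 2) (hpν : p * ν ≤ t) {a b : ℝ} (ha : 0 ≤ a) (hb : 0 ≤ b) (x y : ℕ) :
    ν * (y * (a * (1 + p * x) + b)) +
      (1 + t - ν) * ((a * (y + p * (y * ((y : ℝ) - 1) / 2)) + b * y) -
        (a * (x + p * (x * ((x : ℝ) - 1) / 2)) + b * x)) ≤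
    (1 + t) * (y * (a * (1 + p * ((y : ℝ) - 1)) + b)) -
      (1 - ν) * (x * (a * (1 + p * ((x : ℝ) - 1)) + b)) := by
  have hx : (0 : ℝ) ≤ x := x.cast_nonneg
  have ht0 : 0 < t := by linarith
  have hbx : 0 ≤ b * (t * x) := by positivity
  have key : ν * (y * (1 + p * x)) + (1 + t - ν) * ((y + p * (y * ((y : ℝ) - 1) / 2)) -
      (x + p * (x * ((x : ℝ) - 1) / 2))) ≤
      (1 + t) * (y * (1 + p * ((y : ℝ) - 1))) - (1 - ν) * (x * (1 + p * ((x : ℝ) - 1))) := by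
    have hν' : ν = (1 - t ^ 2) / (2 * t) := by field_simp; linarith
    have hq := mul_le_mul_of_nonneg_left (sq_add_nonneg_of_nat ht ht1 x y)
      (show 0 ≤ p / (4 * t) by positivity)
    have hl := mul_nonneg (sub_nonneg.2 hpν) hx
    have e : (1 + t) * (y * (1 + p * ((y : ℝ) - 1))) -
        (1 - ν) * (x * (1 + p * ((x : ℝ) - 1))) -
        (ν * (y * (1 + p * x)) + (1 + t - ν) * ((y + p * (y * ((y : ℝ) - 1) / 2)) -
          (x + p * (x * ((x : ℝ) - 1) / 2)))) =
        (p / (4 * t) * (((1 - t) * x - (1 + t) * y) ^ 2 + (1 - t) * (1 + 3 * t) * x) -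
          p / (4 * t) * ((1 + t) ^ 2 * y)) + (t - p * ν) * x := by
      rw [hν']
      field_simp
      ring
    linarith
  nlinarith [mul_le_mul_of_nonneg_left key ha]

/-- The price of stability is at most `1 + t`, as witnessed by a minimizer of the potential. -/
theorem HasExpectedAffineCosts.priceOfStability_le {p t ν : ℝ} (hp : 0 < p) (ht : 1 / 3 ≤ t)
    (ht1 : t < 1) (hν : 2 * t * ν = 1 - t ^ 2) (hpν : p * ν ≤ t) (hνt : ν ≤ 1 + t)
    {a b : Γ.Resource → ℝ} (ha : ∀ e, 0 ≤ a e) (hb : ∀ e, 0 ≤ b e)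
    {C : Γ.Profile → Γ.Player → ℝ} (hC : HasExpectedAffineCosts p a b C) :
    priceOfStability C ≤ ENNReal.ofReal (1 + t) := by
  obtain ⟨s, hs⟩ := Finite.exists_min (potential (Γ := Γ) p a b)
  have heq := hC.isEquilibrium_of_potential_le hs
  have hν0 : 0 ≤ ν := by
    by_contra! h
    nlinarith
  have hle : ∀ o, socialCost C s ≤ (1 + t) * socialCost C o := by
    intro o
    have h1 := mul_le_mul_of_nonneg_left (hC.socialCost_le_of_isEquilibrium hp.le ha heq o) hν0
    have h2 := mul_le_mul_of_nonneg_left (hs o) (sub_nonneg.2 hνt)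
    have h3 := Finset.sum_le_sum fun e (_ : e ∈ Finset.univ) =>
      resource_inequality hp ht ht1 hν hpν (ha e) (hb e) (Γ.loadOf Finset.univ s e)
        (Γ.loadOf Finset.univ o e)
    rw [Finset.sum_add_distrib, Finset.sum_sub_distrib, ← Finset.mul_sum, ← Finset.mul_sum,
      ← Finset.mul_sum, ← Finset.mul_sum, Finset.sum_sub_distrib, ← hC.socialCost_eq,
      ← hC.socialCost_eq] at h3
    unfold potential at h2
    linarith
  refine (iInf₂_le s heq).trans (ENNReal.div_le_of_le_mul ?_)
  unfold optimalCost
  rw [ENNReal.mul_iInf_of_ne (by simp; linarith) ENNReal.ofReal_ne_top]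
  refine le_iInf fun o => ?_
  rw [← ENNReal.ofReal_mul (by linarith)]
  exact ENNReal.ofReal_le_ofReal (hle o)

/-- A lower bound needs a lower bound `E` on the cost of every equilibrium, as the price of
stability refers to the best one. -/
theorem ofReal_div_le_priceOfStability {C : Γ.Profile → Γ.Player → ℝ} {E O : ℝ}
    (hO : 0 < O) (o : Γ.Profile) (ho : socialCost C o ≤ O)
    (h : ∀ s, IsEquilibrium C s → E ≤ socialCost C s) :
    ENNReal.ofReal (E / O) ≤ priceOfStability C := by
  refine le_iInf₂ fun s hs => ?_
  rw [ENNReal.ofReal_div_of_pos hO]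
  exact ENNReal.div_le_div (ENNReal.ofReal_le_ofReal (h s hs))
    ((iInf_le _ o).trans (ENNReal.ofReal_le_ofReal ho))

/-! ### A family of games with a dominant strategy profile -/

/-- Whether a player of the game `gadget` uses a resource when she plays the strategy `b`. The
resource `inl true` is common to all players, `inl false` is an outside option, and `inr (i, j)` is
the link from `i` to `j`. A free player `inl i` chooses between the common resource together with
the links from `i` (`b = true`) and the outside option together with the links to `i`
(`b = false`). A fixed player `inr k` always uses the common resource alone. The diagonal link
`inr (i, i)` belongs to both strategies of player `i` and never matters; it is kept so that the
load of `inr (j, k)` is given by one formula. -/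
def gadgetUses (n K : ℕ) : Fin n ⊕ Fin K → Bool → Bool ⊕ (Fin n × Fin n) → Bool
  | .inl _, b, .inl c => b == c
  | .inl i, b, .inr (j, k) => bif b then decide (j = i) else decide (k = i)
  | .inr _, _, .inl c => c
  | .inr _, _, .inr _ => false

/-- The strategy `b` of the player `l` in the game `gadget`, as a set of resources. -/
def gadgetStrategy (n K : ℕ) (l : Fin n ⊕ Fin K) (b : Bool) : Finset (Bool ⊕ (Fin n × Fin n)) :=
  Finset.univ.filter fun e => gadgetUses n K l b e

/-- The game of `n` free and `K` fixed players described in `gadgetUses`, with arbitrary costs. -/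
abbrev gadget (n K : ℕ) (c : Bool ⊕ (Fin n × Fin n) → ℕ → ℝ) (hc : ∀ e k, 0 ≤ c e k) :
    CongestionGame where
  Player := Fin n ⊕ Fin K
  Resource := Bool ⊕ (Fin n × Fin n)
  strategies l := Finset.univ.image (gadgetStrategy n K l)
  strategies_nonempty _ := Finset.univ_nonempty.image _
  cost := c
  cost_nonneg := hc

section Gadget

variable {n K : ℕ} {c : Bool ⊕ (Fin n × Fin n) → ℕ → ℝ} {hc : ∀ e k, 0 ≤ c e k}

/-- The strategy `b` as an element of the set of strategies. -/
def gadgetChoice (n K : ℕ) (c : Bool ⊕ (Fin n × Fin n) → ℕ → ℝ) (hc : ∀ e k, 0 ≤ c e k)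
    (l : Fin n ⊕ Fin K) (b : Bool) :
    {t : Finset (Bool ⊕ (Fin n × Fin n)) // t ∈ (gadget n K c hc).strategies l} :=
  ⟨gadgetStrategy n K l b, Finset.mem_image_of_mem _ (Finset.mem_univ b)⟩

/-- The profile in which each player `l` plays the strategy `b l`. -/
def gadgetProfile (n K : ℕ) (c : Bool ⊕ (Fin n × Fin n) → ℕ → ℝ) (hc : ∀ e k, 0 ≤ c e k)
    (b : Fin n ⊕ Fin K → Bool) : (gadget n K c hc).Profile :=
  fun l => gadgetChoice n K c hc l (b l)

theorem exists_eq_gadgetProfile (s : (gadget n K c hc).Profile) :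
    ∃ b, s = gadgetProfile n K c hc b := by
  have h : ∀ l : Fin n ⊕ Fin K, ∃ b, s l = gadgetChoice n K c hc l b := fun l => by
    obtain ⟨b, -, hb⟩ := Finset.mem_image.1 (s l).2
    exact ⟨b, Subtype.ext hb.symm⟩
  choose b hb using h
  exact ⟨b, funext hb⟩

theorem update_gadgetProfile (b : Fin n ⊕ Fin K → Bool) (l : Fin n ⊕ Fin K) (d : Bool) :
    (Function.update (gadgetProfile n K c hc b : (gadget n K c hc).Profile) l
      (gadgetChoice n K c hc l d) : (gadget n K c hc).Profile) =
      gadgetProfile n K c hc (Function.update b l d) := by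
  funext m
  by_cases h : m = l
  · subst h
    simp only [gadgetProfile, Function.update_self]
  · rw [Function.update_of_ne h]
    simp only [gadgetProfile]
    rw [Function.update_of_ne h]

theorem loadOf_gadgetProfile (b : Fin n ⊕ Fin K → Bool) (e : Bool ⊕ (Fin n × Fin n)) :
    ((gadget n K c hc).loadOf Finset.univ (gadgetProfile n K c hc b) e : ℝ) =
      ∑ l, if gadgetUses n K l (b l) e then (1 : ℝ) else 0 := by
  rw [Finset.sum_boole, loadOf]
  congr 2
  ext l
  simp [gadgetProfile, gadgetChoice, gadgetStrategy]

theorem loadOf_gadgetProfile_common (b : Fin n ⊕ Fin K → Bool) :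
    ((gadget n K c hc).loadOf Finset.univ (gadgetProfile n K c hc b) (.inl true) : ℝ) =
      (∑ i, if b (.inl i) then (1 : ℝ) else 0) + K := by
  rw [loadOf_gadgetProfile, Fintype.sum_sum_type]
  simp [gadgetUses]

theorem loadOf_gadgetProfile_outside (b : Fin n ⊕ Fin K → Bool) :
    ((gadget n K c hc).loadOf Finset.univ (gadgetProfile n K c hc b) (.inl false) : ℝ) =
      ∑ i, if b (.inl i) then (0 : ℝ) else 1 := by
  rw [loadOf_gadgetProfile, Fintype.sum_sum_type]
  simp only [gadgetUses]
  simp only [Bool.false_eq_true, if_false, Finset.sum_const_zero, add_zero]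
  exact Finset.sum_congr rfl fun i _ => by cases b (.inl i) <;> simp

theorem loadOf_gadgetProfile_link (b : Fin n ⊕ Fin K → Bool) (j k : Fin n) :
    ((gadget n K c hc).loadOf Finset.univ (gadgetProfile n K c hc b) (.inr (j, k)) : ℝ) =
      (if b (.inl j) then (1 : ℝ) else 0) + if b (.inl k) then (0 : ℝ) else 1 := by
  rw [loadOf_gadgetProfile, Fintype.sum_sum_type]
  have h1 : ∀ i, (if gadgetUses n K (.inl i) (b (.inl i)) (.inr (j, k)) then (1 : ℝ) else 0) =
      (if j = i then (if b (.inl i) then (1 : ℝ) else 0) else 0) +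
        (if k = i then (if b (.inl i) then (0 : ℝ) else 1) else 0) := fun i => by
    cases h : b (.inl i) <;> simp [gadgetUses]
  have h2 : ∀ i, (if gadgetUses n K (.inr i) (b (.inr i)) (.inr (j, k)) then (1 : ℝ) else 0) = 0 :=
    fun i => by simp [gadgetUses]
  simp_rw [h1, h2]
  rw [Finset.sum_add_distrib]
  simp

/-- The slopes for `gadget`: `1` on the common resource, `0` outside, and `β` on the links. -/
def gadgetSlope (n : ℕ) (β : ℝ) : Bool ⊕ (Fin n × Fin n) → ℝ
  | .inl d => bif d then 1 else 0
  | .inr _ => β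

/-- The constant costs for `gadget`: `α` outside, and `0` elsewhere. -/
def gadgetConst (n : ℕ) (α : ℝ) : Bool ⊕ (Fin n × Fin n) → ℝ
  | .inl d => bif d then 0 else α
  | .inr _ => 0

variable {p α β : ℝ} {C : (gadget n K c hc).Profile → Fin n ⊕ Fin K → ℝ}

theorem gadgetCost_common (hC : HasExpectedAffineCosts p (gadgetSlope n β) (gadgetConst n α) C)
    (b : Fin n ⊕ Fin K → Bool) (i : Fin n) (hi : b (.inl i) = true) :
    C (gadgetProfile n K c hc b) (.inl i) =
      1 + p * ((∑ i, if b (.inl i) then (1 : ℝ) else 0) + K - 1) +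
        β * (n + p * (n - ∑ i, if b (.inl i) then (1 : ℝ) else 0)) := by
  have h := hC (gadgetProfile n K c hc b) (.inl i)
  have h1 : ∀ F : Bool ⊕ (Fin n × Fin n) → ℝ,
      ∑ e ∈ (gadgetProfile n K c hc b (.inl i)).1, F e = F (.inl true) + ∑ j, F (.inr (i, j)) := by
    intro F
    simp only [gadgetProfile, gadgetChoice, gadgetStrategy]
    rw [Finset.sum_filter, Fintype.sum_sum_type, Fintype.sum_prod_type]
    simp [gadgetUses, hi]
  have h2 : ∀ j, gadgetSlope n β (.inr (i, j)) * (1 + p * (((gadget n K c hc).loadOf Finset.univ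
      (gadgetProfile n K c hc b) (.inr (i, j)) : ℝ) - 1)) + gadgetConst n α (.inr (i, j)) =
      β * (1 + p * (1 - if b (.inl j) then (1 : ℝ) else 0)) := fun j => by
    rw [loadOf_gadgetProfile_link b i j, hi]
    cases b (.inl j) <;> simp [gadgetSlope, gadgetConst]
  rw [h1] at h
  rw [h, loadOf_gadgetProfile_common, Finset.sum_congr rfl fun j _ => h2 j, ← Finset.mul_sum,
    Finset.sum_add_distrib, ← Finset.mul_sum, Finset.sum_sub_distrib]
  simp [gadgetSlope, gadgetConst]

theorem gadgetCost_outside (hC : HasExpectedAffineCosts p (gadgetSlope n β) (gadgetConst n α) C)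
    (b : Fin n ⊕ Fin K → Bool) (i : Fin n) (hi : b (.inl i) = false) :
    C (gadgetProfile n K c hc b) (.inl i) =
      α + β * (n + p * ∑ i, if b (.inl i) then (1 : ℝ) else 0) := by
  have h := hC (gadgetProfile n K c hc b) (.inl i)
  have h1 : ∀ F : Bool ⊕ (Fin n × Fin n) → ℝ,
      ∑ e ∈ (gadgetProfile n K c hc b (.inl i)).1, F e = F (.inl false) + ∑ j, F (.inr (j, i)) := by
    intro F
    simp only [gadgetProfile, gadgetChoice, gadgetStrategy]
    rw [Finset.sum_filter, Fintype.sum_sum_type, Fintype.sum_prod_type]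
    simp [gadgetUses, hi]
  have h2 : ∀ j, gadgetSlope n β (.inr (j, i)) * (1 + p * (((gadget n K c hc).loadOf Finset.univ
      (gadgetProfile n K c hc b) (.inr (j, i)) : ℝ) - 1)) + gadgetConst n α (.inr (j, i)) =
      β * (1 + p * if b (.inl j) then (1 : ℝ) else 0) := fun j => by
    rw [loadOf_gadgetProfile_link b j i, hi]
    cases b (.inl j) <;> simp [gadgetSlope, gadgetConst]
  rw [h1] at h
  rw [h, Finset.sum_congr rfl fun j _ => h2 j, ← Finset.mul_sum, Finset.sum_add_distrib,
    ← Finset.mul_sum]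
  simp [gadgetSlope, gadgetConst]

/-- If the outside option costs `1 + p * K + p * n * (1 - β)` with `β ≤ 1 / 2`, the common resource
is strictly dominant for the free players. -/
theorem eq_true_of_isEquilibrium_gadgetProfile (hp : 0 < p) (hβ : β ≤ 1 / 2)
    (hα : α = 1 + p * K + p * n * (1 - β))
    (hC : HasExpectedAffineCosts p (gadgetSlope n β) (gadgetConst n α) C)
    {b : Fin n ⊕ Fin K → Bool} (hb : IsEquilibrium C (gadgetProfile n K c hc b)) (i : Fin n) :
    b (.inl i) = true := by
  by_contra hi
  rw [Bool.not_eq_true] at hi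
  have h := hb (.inl i) (gadgetChoice n K c hc (.inl i) true)
  rw [update_gadgetProfile, gadgetCost_outside hC b i hi, gadgetCost_common hC _ i (by simp)] at h
  have hsum : (∑ j, if Function.update b (.inl i) true (.inl j) then (1 : ℝ) else 0) =
      (∑ j, if b (.inl j) then (1 : ℝ) else 0) + 1 := by
    rw [← Finset.add_sum_erase _ _ (Finset.mem_univ i),
      ← Finset.add_sum_erase (a := i) Finset.univ (fun j => if b (.inl j) then (1 : ℝ) else 0)
        (Finset.mem_univ i)]
    rw [Finset.sum_congr rfl fun j hj => by
      rw [Function.update_of_ne (by simpa using Finset.ne_of_mem_erase hj)]]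
    simp [hi]
    ring
  rw [hsum, hα] at h
  have hk : (∑ j, if b (.inl j) then (1 : ℝ) else 0) + 1 ≤ (n : ℝ) := by
    have := Finset.sum_lt_sum (s := Finset.univ)
      (f := fun j => if b (.inl j) then (1 : ℝ) else 0) (g := fun _ => 1)
      (fun j _ => by split_ifs <;> simp) ⟨i, Finset.mem_univ i, by simp [hi]⟩
    simp only [Finset.sum_boole, Finset.sum_const, Finset.card_univ, Fintype.card_fin,
      nsmul_eq_mul, mul_one] at this ⊢
    exact_mod_cast this
  generalize (∑ j, if b (.inl j) then (1 : ℝ) else 0) = k at h hk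
  have h1 : 0 ≤ p * ((n - k - 1) * (1 - 2 * β)) :=
    mul_nonneg hp.le (mul_nonneg (by linarith) (by linarith))
  nlinarith [mul_le_mul_of_nonneg_left hβ hp.le]

theorem socialCost_gadgetProfile_of_forall_true
    (hC : HasExpectedAffineCosts p (gadgetSlope n β) (gadgetConst n α) C)
    {b : Fin n ⊕ Fin K → Bool} (hb : ∀ i, b (.inl i) = true) :
    socialCost C (gadgetProfile n K c hc b) =
      (n + K) * (1 + p * ((n : ℝ) + K - 1)) + n ^ 2 * β := by
  have h := hC.socialCost_eq (gadgetProfile n K c hc b)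
  rw [Fintype.sum_sum_type, Fintype.sum_prod_type, Fintype.sum_bool,
    loadOf_gadgetProfile_common, loadOf_gadgetProfile_outside] at h
  rw [h, Finset.sum_congr rfl fun j _ => Finset.sum_congr rfl fun k _ => by
    rw [loadOf_gadgetProfile_link b j k]]
  simp [gadgetSlope, gadgetConst, hb]
  ring

theorem socialCost_gadgetProfile_of_forall_false
    (hC : HasExpectedAffineCosts p (gadgetSlope n β) (gadgetConst n α) C)
    {b : Fin n ⊕ Fin K → Bool} (hb : ∀ i, b (.inl i) = false) :
    socialCost C (gadgetProfile n K c hc b) =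
      K * (1 + p * ((K : ℝ) - 1)) + n * α + n ^ 2 * β := by
  have h := hC.socialCost_eq (gadgetProfile n K c hc b)
  rw [Fintype.sum_sum_type, Fintype.sum_prod_type, Fintype.sum_bool,
    loadOf_gadgetProfile_common, loadOf_gadgetProfile_outside] at h
  rw [h, Finset.sum_congr rfl fun j _ => Finset.sum_congr rfl fun k _ => by
    rw [loadOf_gadgetProfile_link b j k]]
  simp [gadgetSlope, gadgetConst, hb]
  ring

end Gadget

/-! ### The ratio of the social costs in the limit -/

/-- The social cost in `gadget n K` when all players use the common resource. -/
noncomputable def gadgetCommonCost (p β : ℝ) (n K : ℕ) : ℝ :=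
  (n + K) * (1 + p * ((n : ℝ) + K - 1)) + n ^ 2 * β

/-- The social cost in `gadget n K` when all free players take the outside option, priced at
`1 + p * K + p * n * (1 - β)`. -/
noncomputable def gadgetOutsideCost (p β : ℝ) (n K : ℕ) : ℝ :=
  K * (1 + p * ((K : ℝ) - 1)) + n * (1 + p * K + p * n * (1 - β)) + n ^ 2 * β

theorem gadgetCommonCost_nonneg {p β : ℝ} (hp : 0 < p) (hp1 : p ≤ 1) (hβ0 : 0 ≤ β) (n K : ℕ) :
    0 ≤ gadgetCommonCost p β n K := by
  have h : 0 ≤ ((n : ℝ) + K) * ((1 - p) + p * (n + K)) :=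
    mul_nonneg (by positivity) (add_nonneg (by linarith) (by positivity))
  have h2 : 0 ≤ (n : ℝ) ^ 2 * β := by positivity
  unfold gadgetCommonCost
  linarith

theorem gadget_le_priceOfStability {n K : ℕ} {c : Bool ⊕ (Fin n × Fin n) → ℕ → ℝ}
    {hc : ∀ e k, 0 ≤ c e k} {p β : ℝ} (hp : 0 < p) (hp1 : p ≤ 1) (hβ0 : 0 ≤ β) (hβ : β ≤ 1 / 2)
    {C : (gadget n K c hc).Profile → Fin n ⊕ Fin K → ℝ}
    (hC : HasExpectedAffineCosts p (gadgetSlope n β)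
      (gadgetConst n (1 + p * K + p * n * (1 - β))) C) :
    ENNReal.ofReal (gadgetCommonCost p β n K / gadgetOutsideCost p β n K) ≤
      priceOfStability C := by
  by_cases hO : 0 < gadgetOutsideCost p β n K
  · refine ofReal_div_le_priceOfStability hO (gadgetProfile n K c hc fun _ => false)
      (socialCost_gadgetProfile_of_forall_false hC fun _ => rfl).le fun s hs => ?_
    obtain ⟨b, rfl⟩ := exists_eq_gadgetProfile s
    exact (socialCost_gadgetProfile_of_forall_true hC
      (eq_true_of_isEquilibrium_gadgetProfile hp hβ rfl hC hs)).ge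
  · rw [ENNReal.ofReal_of_nonpos (div_nonpos_of_nonneg_of_nonpos
      (gadgetCommonCost_nonneg hp hp1 hβ0 n K) (not_lt.1 hO))]
    exact bot_le

open Filter Topology in
/-- With `n ≈ 2 * t * m` and `K ≈ (1 - t) * m`, the ratio of the costs tends to `1 + t`: the
two sides of `hid` are the limit of the numerator divided by `m ^ 2`, and `1 + t` times the limit of
the denominator divided by `m ^ 2`. -/
theorem ofReal_le_of_gadget {p t β : ℝ} (hp : 0 < p) (ht : 0 < t) (ht1 : t < 1) (hβ0 : 0 ≤ β)
    (hβ : β ≤ 1 / 2)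
    (hid : p * (1 + t) ^ 2 + 4 * β * t ^ 2 =
      (1 + t) * (p * (1 + 3 * t ^ 2 - 4 * β * t ^ 2) + 4 * β * t ^ 2)) {S : ℝ≥0∞}
    (hS : ∀ n K : ℕ,
      ENNReal.ofReal (gadgetCommonCost p β n K / gadgetOutsideCost p β n K) ≤ S) :
    ENNReal.ofReal (1 + t) ≤ S := by
  have hx : Tendsto (fun m : ℕ => (⌊2 * t * (m : ℝ)⌋₊ : ℝ) / m) atTop (𝓝 (2 * t)) :=
    (tendsto_nat_floor_mul_div_atTop (by positivity)).comp tendsto_natCast_atTop_atTop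
  have hy : Tendsto (fun m : ℕ => (⌊(1 - t) * (m : ℝ)⌋₊ : ℝ) / m) atTop (𝓝 (1 - t)) :=
    (tendsto_nat_floor_mul_div_atTop (by linarith)).comp tendsto_natCast_atTop_atTop
  have hz : Tendsto (fun m : ℕ => 1 / (m : ℝ)) atTop (𝓝 0) := tendsto_one_div_atTop_nhds_zero_nat
  have hden : 0 < p * (1 + 3 * t ^ 2 - 4 * β * t ^ 2) + 4 * β * t ^ 2 := by
    have h1 : 0 ≤ (1 / 2 - β) * t ^ 2 := mul_nonneg (by linarith) (sq_nonneg t)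
    have h2 : 0 < 1 + 3 * t ^ 2 - 4 * β * t ^ 2 := by nlinarith [sq_nonneg t]
    positivity
  -- The ratio of the costs, scaled by `m ^ 2`, as a function of `(n / m, K / m, 1 / m)`.
  let G : ℝ × ℝ × ℝ → ℝ := fun v =>
    ((v.1 + v.2.1) * (v.2.2 + p * (v.1 + v.2.1 - v.2.2)) + v.1 ^ 2 * β) /
      (v.2.1 * (v.2.2 + p * (v.2.1 - v.2.2)) +
        v.1 * (v.2.2 + p * v.2.1 + p * v.1 * (1 - β)) + v.1 ^ 2 * β)
  have hG0 : G (2 * t, 1 - t, 0) = 1 + t := by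
    simp only [G]
    rw [div_eq_iff (by ring_nf at hden ⊢; exact hden.ne')]
    linarith
  have hG : ContinuousAt G (2 * t, 1 - t, 0) := by
    refine ContinuousAt.div (by fun_prop) (by fun_prop) ?_
    simp only
    ring_nf at hden ⊢
    exact hden.ne'
  have hlim := hG.tendsto.comp (hx.prodMk_nhds (hy.prodMk_nhds hz))
  rw [hG0] at hlim
  refine le_of_tendsto (ENNReal.tendsto_ofReal hlim) ?_
  filter_upwards [eventually_gt_atTop 0] with m hm
  refine le_trans (le_of_eq ?_) (hS ⌊2 * t * (m : ℝ)⌋₊ ⌊(1 - t) * (m : ℝ)⌋₊)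
  have hm' : (m : ℝ) ≠ 0 := by exact_mod_cast hm.ne'
  congr 1
  simp only [Function.comp, G, gadgetCommonCost, gadgetOutsideCost]
  generalize (⌊2 * t * (m : ℝ)⌋₊ : ℝ) = n
  generalize (⌊(1 - t) * (m : ℝ)⌋₊ : ℝ) = K
  rw [← mul_div_mul_left _ _ (pow_ne_zero 2 hm')]
  congr 1 <;> field_simp

end CongestionGame

/-! ### The worst price of stability of the two classes of games -/

open CongestionGame

theorem gadgetSlope_nonneg {n : ℕ} {β : ℝ} (hβ : 0 ≤ β) (e) : 0 ≤ gadgetSlope n β e := by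
  rcases e with (_ | _) | _ <;> simp [gadgetSlope, hβ]

theorem gadgetConst_nonneg {n : ℕ} {α : ℝ} (hα : 0 ≤ α) (e) : 0 ≤ gadgetConst n α e := by
  rcases e with (_ | _) | _ <;> simp [gadgetConst, hα]

theorem bernoulliWorstPoS_le {p t ν : ℝ} (hp : 0 < p) (ht : 1 / 3 ≤ t)
    (ht1 : t < 1) (hν : 2 * t * ν = 1 - t ^ 2) (hpν : p * ν ≤ t) (hνt : ν ≤ 1 + t) :
    bernoulliWorstPoS p ≤ ENNReal.ofReal (1 + t) := by
  refine iSup₂_le fun Γ hΓ => ?_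
  choose a b ha hb hc using hΓ
  exact (hasExpectedAffineCosts_bernoulliCost p a b hc).priceOfStability_le hp ht ht1 hν hpν hνt
    (fun e => mul_nonneg hp.le (ha e)) (fun e => mul_nonneg hp.le (hb e))

theorem expectedWorstPoS_le {p t ν : ℝ} (hp : 0 < p) (ht : 1 / 3 ≤ t)
    (ht1 : t < 1) (hν : 2 * t * ν = 1 - t ^ 2) (hpν : p * ν ≤ t) (hνt : ν ≤ 1 + t) :
    expectedWorstPoS p ≤ ENNReal.ofReal (1 + t) := by
  refine iSup₂_le fun Γ hΓ => ?_
  choose c hc hce using hΓ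
  choose a b ha hb hc using hc
  exact (hasExpectedAffineCosts_playerCost p a b
    fun e => ⟨c e, hc e, (hce e).symm⟩).priceOfStability_le hp ht ht1 hν hpν hνt
    (fun e => mul_nonneg hp.le (ha e)) (fun e => mul_nonneg hp.le (hb e))

theorem gadget_le_bernoulliWorstPoS {p β : ℝ} (hp : 0 < p) (hp1 : p ≤ 1) (hβ0 : 0 ≤ β)
    (hβ : β ≤ 1 / 2) (n K : ℕ) :
    ENNReal.ofReal (gadgetCommonCost p β n K / gadgetOutsideCost p β n K) ≤
      bernoulliWorstPoS p := by
  have hα : 0 ≤ 1 + p * K + p * n * (1 - β) := by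
    have : 0 ≤ p * n * (1 - β) := mul_nonneg (by positivity) (by linarith)
    positivity
  -- Dividing by `p` cancels the factor `p` of the expected costs.
  let a := fun e => gadgetSlope n β e / p
  let b := fun e => gadgetConst n (1 + p * K + p * n * (1 - β)) e / p
  have ha : ∀ e, 0 ≤ a e := fun e => div_nonneg (gadgetSlope_nonneg hβ0 e) hp.le
  have hb : ∀ e, 0 ≤ b e := fun e => div_nonneg (gadgetConst_nonneg hα e) hp.le
  let Γ := gadget n K (fun e x => a e * x + b e) fun e k =>
    add_nonneg (mul_nonneg (ha e) k.cast_nonneg) (hb e)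
  have hC := hasExpectedAffineCosts_bernoulliCost (Γ := Γ) p a b fun _ _ => rfl
  simp only [a, b, mul_div_cancel₀ _ hp.ne'] at hC
  exact (gadget_le_priceOfStability hp hp1 hβ0 hβ hC).trans
    (le_iSup₂_of_le Γ (fun e => ⟨a e, b e, ha e, hb e, fun _ => rfl⟩) le_rfl)

theorem gadget_le_expectedWorstPoS {p β : ℝ} (hp : 0 < p) (hp1 : p ≤ 1) (hβ0 : 0 ≤ β)
    (hβ : β ≤ 1 / 2) (n K : ℕ) :
    ENNReal.ofReal (gadgetCommonCost p β n K / gadgetOutsideCost p β n K) ≤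
      expectedWorstPoS p := by
  have hα : 0 ≤ 1 + p * K + p * n * (1 - β) := by
    have : 0 ≤ p * n * (1 - β) := mul_nonneg (by positivity) (by linarith)
    positivity
  -- Dividing by `p` cancels the factor `p` of the expected costs.
  let a := fun e => gadgetSlope n β e / p
  let b := fun e => gadgetConst n (1 + p * K + p * n * (1 - β)) e / p
  have ha : ∀ e, 0 ≤ a e := fun e => div_nonneg (gadgetSlope_nonneg hβ0 e) hp.le
  have hb : ∀ e, 0 ≤ b e := fun e => div_nonneg (gadgetConst_nonneg hα e) hp.le
  let Γ := gadget n K (fun e => expectedCost p fun x => a e * x + b e) fun e k => by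
    rw [expectedCost_affine p _ _ _ fun _ => rfl]
    have := ha e
    have := hb e
    positivity
  have hC := hasExpectedAffineCosts_playerCost (Γ := Γ) p a b
    fun e => ⟨fun x => a e * x + b e, fun _ => rfl, rfl⟩
  simp only [a, b, mul_div_cancel₀ _ hp.ne'] at hC
  exact (gadget_le_priceOfStability hp hp1 hβ0 hβ hC).trans
    (le_iSup₂_of_le Γ (fun e => ⟨_, ⟨a e, b e, ha e, hb e, fun _ => rfl⟩, rfl⟩) le_rfl)

/-- The parameters `ν` and `β` are those of the upper and of the lower bound. -/
theorem worstPoS_eq {p t ν β : ℝ} (hp : 0 < p) (hp1 : p ≤ 1) (ht : 1 / 3 ≤ t)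
    (ht1 : t < 1) (hν : 2 * t * ν = 1 - t ^ 2) (hpν : p * ν ≤ t) (hνt : ν ≤ 1 + t) (hβ0 : 0 ≤ β)
    (hβ : β ≤ 1 / 2)
    (hid : p * (1 + t) ^ 2 + 4 * β * t ^ 2 =
      (1 + t) * (p * (1 + 3 * t ^ 2 - 4 * β * t ^ 2) + 4 * β * t ^ 2)) :
    bernoulliWorstPoS p = ENNReal.ofReal (1 + t) ∧ expectedWorstPoS p = ENNReal.ofReal (1 + t) :=
  ⟨(bernoulliWorstPoS_le hp ht ht1 hν hpν hνt).antisymm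
      (ofReal_le_of_gadget hp (by linarith) ht1 hβ0 hβ hid
        (gadget_le_bernoulliWorstPoS hp hp1 hβ0 hβ)),
    (expectedWorstPoS_le hp ht ht1 hν hpν hνt).antisymm
      (ofReal_le_of_gadget hp (by linarith) ht1 hβ0 hβ hid
        (gadget_le_expectedWorstPoS hp hp1 hβ0 hβ))⟩

theorem mainTheorem7 (p : ℝ) (hp0 : 0 < p) (hp1 : p ≤ 1) :
    (p ≤ 1 / 4 → bernoulliWorstPoS p = 4 / 3 ∧ expectedWorstPoS p = 4 / 3) ∧
    (1 / 4 ≤ p →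
      bernoulliWorstPoS p = ENNReal.ofReal (1 + Real.sqrt (p / (2 + p))) ∧
      expectedWorstPoS p = ENNReal.ofReal (1 + Real.sqrt (p / (2 + p)))) := by
  constructor
  · intro hp
    have h : ENNReal.ofReal (1 + 1 / 3) = 4 / 3 := by
      rw [show (1 + 1 / 3 : ℝ) = 4 / 3 by norm_num, ENNReal.ofReal_div_of_pos (by norm_num)]
      norm_num
    rw [← h]
    -- `ν = 1 + t`: the potential carries no weight; the links are free, as in Pigou's network.
    exact worstPoS_eq (ν := 4 / 3) (β := 0) hp0 hp1 le_rfl (by norm_num) (by norm_num)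
      (by linarith) (by norm_num) le_rfl (by norm_num) (by ring)
  · intro hp
    have ht2 : Real.sqrt (p / (2 + p)) ^ 2 = p / (2 + p) := Real.sq_sqrt (by positivity)
    have ht0 : 0 ≤ Real.sqrt (p / (2 + p)) := Real.sqrt_nonneg _
    generalize Real.sqrt (p / (2 + p)) = t at ht2 ht0
    have hpt : t ^ 2 * (2 + p) = p := by rw [ht2]; field_simp
    have ht : 1 / 3 ≤ t := by
      refine (sq_le_sq₀ (by norm_num) ht0).1 ?_
      rw [ht2, le_div_iff₀ (by positivity)]
      linarith
    have ht1 : t < 1 := by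
      refine (sq_lt_sq₀ ht0 zero_le_one).1 ?_
      rw [ht2, div_lt_iff₀ (by positivity)]
      linarith
    refine worstPoS_eq (ν := t / p) (β := 1 / 2) hp0 hp1 ht ht1 ?_ ?_ ?_ (by norm_num) le_rfl ?_
    · field_simp
      linarith
    · rw [mul_div_cancel₀ _ hp0.ne']
    · -- Equivalent to `t * (1 - p) ≤ p`, hence by squaring to `1 ≤ 4 * p`.
      have hsq : t * (1 - p) ≤ p := by
        refine (sq_le_sq₀ (mul_nonneg ht0 (by linarith)) hp0.le).1 ?_
        rw [mul_pow, ht2, div_mul_eq_mul_div, div_le_iff₀ (by positivity)]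
        nlinarith [mul_nonneg hp0.le (by linarith : 0 ≤ 4 * p - 1)]
      rw [div_le_iff₀ hp0]
      linarith
    · linear_combination -t * hpt
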